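/- Theorem 4.3. Let $A$ be an abelian variety over $\mathbb C$ and let $G$ be a finite group acting on $A$ by automorphisms of the abelian variety. Let $\rho:\mathbb Q[G]\to \mathrm{End}_{\mathbb Q}(A)=\mathrm{End}(A)\otimes\mathbb Q$ be the induced algebra homomorphism. For $\alpha\in\mathbb Q[G]$ put $\mathrm{Im}(\alpha):=\mathrm{Im}(n\alpha)\subseteq A$, where $n$ is any positive integer such that $n\rho(\alpha)$ lies in $\mathrm{End}(A)$; this does not depend on $n$. Let $H\le G$ be a subgroup, $p_H=\frac1{|H|}\sum_{h\in H}h$ and $A_H=\mathrm{Im}(p_H)$. Let $H_1,\dots,H_s$ be the double cosets of $H$ in $G$ and let $$q_i=\frac1{|H|}\sum_{h\in H_i}h\qquad(1\le i\le s),$$ the standard basis of the Hecke algebra $\mathcal H_H=p_H\mathbb Q[G]p_H$. Let $V$ be an irreducible complex representation of $G$ with character $\chi_V$, extended linearly to $\mathbb Q[G]$, and let $K$ be the field generated over $\mathbb Q$ by the values of $\chi_V$ on $G$. Let $W$ be the irreducible rational representation of $G$ Galois associated to $V$ (that is, $V$ occurs in $W\otimes_{\mathbb Q}\mathbb C$),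 and put $$e_W=\frac{\dim V}{|G|}\sum_{g\in G}\mathrm{tr}_{K/\mathbb Q}\big(\chi_V(g^{-1})\big)\,g,\qquad f_{H,\widetilde W}=p_He_W,\qquad A_{H,\widetilde W}=\mathrm{Im}(f_{H,\widetilde W})\subseteq A_H .$$ Assume that $\dim V^H=1$ and that $\chi_V$ is rational-valued, i.e. $K=\mathbb Q$. Then for every $i$ there is exactly one endomorphism of the abelian variety $A_H$ that induces the action of $q_i$ on $A_H$ (denoted again by $q_i$), the number $\chi_V(q_i)$ is an integer, and $$A_{H,\widetilde W}=B_{H,\widetilde W}:=\{z\in A_H \;:\; q_i(z)=\chi_V(q_i)\,z \text{ for } i=1,\dots,s\}_0,$$ where the index $0$ denotes the connected component containing $0$. -/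

import Mathlib

open scoped TensorProduct

noncomputable section

namespace HeckeAV

/-! ### Complex tori, abelian varieties and their endomorphisms -/

section Torus

variable {E : Type*} [NormedAddCommGroup E] [NormedSpace ℂ E] (Λ : Submodule ℤ E)

/-- The complex torus `E / Λ` carries a polarization: a positive definite Hermitian form on `E`
whose imaginary part takes integral values on `Λ`. Abelian varieties over `ℂ` are exactly the
complex tori with this property. -/
def IsAbelianVariety : Prop :=
  ∃ S : E →ₗ⋆[ℂ] E →ₗ[ℂ] ℂ,
    (∀ x y, S y x = starRingEnd ℂ (S x y)) ∧
    (∀ x, x ≠ 0 → 0 < (S x x).re) ∧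
    (∀ x ∈ Λ, ∀ y ∈ Λ, ∃ m : ℤ, (S x y).im = m)

/-- A map `E / Λ → E / Λ` is holomorphic: the projection `E → E / Λ` being a local
biholomorphism, this means that near every point the map is given by a holomorphic map on `E`. -/
def IsHolomorphic (f : E ⧸ Λ → E ⧸ Λ) : Prop :=
  ∀ x : E, ∃ φ : E → E, AnalyticAt ℂ φ x ∧ ∀ᶠ y in nhds x, f (Λ.mkQ y) = Λ.mkQ (φ y)

/-- A self-map of a subgroup `B` of `E / Λ` is holomorphic: near every point of `B` it is the
restriction of a holomorphic map of the ambient space. -/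
def IsHolomorphicOn (B : AddSubgroup (E ⧸ Λ)) (f : B → B) : Prop :=
  ∀ x : E, Λ.mkQ x ∈ B → ∃ φ : E → E, AnalyticAt ℂ φ x ∧
    ∀ᶠ y in nhds x, ∀ hy : Λ.mkQ y ∈ B, (f ⟨Λ.mkQ y, hy⟩ : E ⧸ Λ) = Λ.mkQ (φ y)

/-- `End(A)`, the ring of holomorphic group endomorphisms of `A = E / Λ`. -/
def torusEnd : Subring (AddMonoid.End (E ⧸ Λ)) where
  carrier := {f | IsHolomorphic Λ f}
  mul_mem' := by
    intro f g hf hg x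
    obtain ⟨φ, hφ, h1⟩ := hg x
    obtain ⟨ψ, hψ, h2⟩ := hf (φ x)
    refine ⟨ψ ∘ φ, hψ.comp hφ, ?_⟩
    filter_upwards [h1, hφ.continuousAt.eventually h2] with y hy1 hy2
    change f (g (Λ.mkQ y)) = _
    rw [hy1, hy2]
    rfl
  one_mem' := fun x => ⟨id, analyticAt_id, by simp⟩
  add_mem' := by
    intro f g hf hg x
    obtain ⟨φ, hφ, h1⟩ := hf x
    obtain ⟨ψ, hψ, h2⟩ := hg x
    refine ⟨φ + ψ, hφ.add hψ, ?_⟩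
    filter_upwards [h1, h2] with y hy1 hy2
    change f (Λ.mkQ y) + g (Λ.mkQ y) = _
    rw [hy1, hy2, Pi.add_apply, map_add]
  zero_mem' := fun x => ⟨0, analyticAt_const, by simp⟩
  neg_mem' := by
    intro f hf x
    obtain ⟨φ, hφ, h1⟩ := hf x
    refine ⟨-φ, hφ.neg, ?_⟩
    filter_upwards [h1] with y hy1
    change -f (Λ.mkQ y) = _
    rw [hy1, Pi.neg_apply, map_neg]

/-- `End(B)`, the ring of holomorphic group endomorphisms of an abelian subvariety `B` of
`A = E / Λ`. -/
def subEnd (B : AddSubgroup (E ⧸ Λ)) : Subring (AddMonoid.End B) where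
  carrier := {f | IsHolomorphicOn Λ B f}
  mul_mem' := by
    intro f g hf hg x hx
    obtain ⟨φ, hφ, h1⟩ := hg x hx
    have hx1 := h1.self_of_nhds hx
    obtain ⟨ψ, hψ, h2⟩ := hf (φ x) (hx1 ▸ (g ⟨Λ.mkQ x, hx⟩).2)
    refine ⟨ψ ∘ φ, hψ.comp hφ, ?_⟩
    filter_upwards [h1, hφ.continuousAt.eventually h2] with y hy1 hy2 hy
    have e := hy1 hy
    have hm : Λ.mkQ (φ y) ∈ B := e ▸ (g ⟨Λ.mkQ y, hy⟩).2
    have e2 : g ⟨Λ.mkQ y, hy⟩ = ⟨Λ.mkQ (φ y), hm⟩ := Subtype.ext e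
    change (f (g ⟨Λ.mkQ y, hy⟩) : E ⧸ Λ) = _
    rw [e2]
    exact hy2 hm
  one_mem' := fun x _ => ⟨id, analyticAt_id, by simp⟩
  add_mem' := by
    intro f g hf hg x hx
    obtain ⟨φ, hφ, h1⟩ := hf x hx
    obtain ⟨ψ, hψ, h2⟩ := hg x hx
    refine ⟨φ + ψ, hφ.add hψ, ?_⟩
    filter_upwards [h1, h2] with y hy1 hy2 hy
    change ((f ⟨Λ.mkQ y, hy⟩ + g ⟨Λ.mkQ y, hy⟩ : B) : E ⧸ Λ) = _
    rw [AddSubgroup.coe_add, hy1 hy, hy2 hy, Pi.add_apply, map_add]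
  zero_mem' := fun x _ => ⟨0, analyticAt_const, by simp⟩
  neg_mem' := by
    intro f hf x hx
    obtain ⟨φ, hφ, h1⟩ := hf x hx
    refine ⟨-φ, hφ.neg, ?_⟩
    filter_upwards [h1] with y hy1 hy
    change ((-f ⟨Λ.mkQ y, hy⟩ : B) : E ⧸ Λ) = _
    rw [AddSubgroup.coe_neg, hy1 hy, Pi.neg_apply, map_neg]

/-- The rational endomorphism algebra `End_ℚ(A) = End(A) ⊗ ℚ`. -/
abbrev EndQ : Type _ := ℚ ⊗[ℤ] torusEnd Λ

/-- The canonical map `End(A) → End_ℚ(A)`. -/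
def toEndQ : torusEnd Λ →ₐ[ℤ] EndQ Λ := Algebra.TensorProduct.includeRight

theorem divisible (n : ℕ) (hn : 0 < n) (z : E ⧸ Λ) : ∃ w : E ⧸ Λ, n • w = z := by
  obtain ⟨x, rfl⟩ := Λ.mkQ_surjective z
  refine ⟨Λ.mkQ ((n : ℂ)⁻¹ • x), ?_⟩
  rw [← map_nsmul, ← Nat.cast_smul_eq_nsmul ℂ, smul_smul, mul_inv_cancel₀, one_smul]
  exact_mod_cast hn.ne'

theorem toEndQ_injective : Function.Injective (toEndQ Λ) := by
  have : Module.IsTorsionFree ℤ (torusEnd Λ) := by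
    rw [Module.isTorsionFree_int_iff_isAddTorsionFree]
    refine ⟨fun n hn f g hfg => ?_⟩
    ext z
    obtain ⟨w, rfl⟩ := divisible Λ n (Nat.pos_of_ne_zero hn) z
    have h := congrArg (fun k : torusEnd Λ => (k : AddMonoid.End (E ⧸ Λ)) w) hfg
    simpa using h
  exact Algebra.TensorProduct.includeRight_injective Int.cast_injective

variable {Λ} in
/-- The algebra homomorphism `ℚ[G] → End_ℚ(A)` induced by an action of `G` on `A`. -/
def groupAlgebraHom {G : Type*} [Group G] (ρ : G →* torusEnd Λ) :
    MonoidAlgebra ℚ G →ₐ[ℚ] EndQ Λ :=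
  MonoidAlgebra.lift ℚ (EndQ Λ) G ((toEndQ Λ : torusEnd Λ →* EndQ Λ).comp ρ)

variable {Λ} in
/-- The endomorphism `φ` of `A` is the multiple `n α` of `α ∈ ℚ[G]`. -/
def IsMultiple {G : Type*} [Group G] (ρ : G →* torusEnd Λ) (α : MonoidAlgebra ℚ G) (n : ℕ)
    (φ : torusEnd Λ) : Prop :=
  n • groupAlgebraHom ρ α = toEndQ Λ φ

variable {Λ} in
/-- The image of an endomorphism of `A`. -/
def endRange (φ : torusEnd Λ) : AddSubgroup (E ⧸ Λ) where
  carrier := Set.range (φ : AddMonoid.End (E ⧸ Λ))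
  zero_mem' := ⟨0, map_zero _⟩
  add_mem' := by
    rintro _ _ ⟨x, rfl⟩ ⟨y, rfl⟩
    exact ⟨x + y, map_add _ x y⟩
  neg_mem' := by
    rintro _ ⟨x, rfl⟩
    exact ⟨-x, map_neg _ x⟩

variable {Λ} in
/-- The abelian subvariety `Im(α) = Im(nα)` of `A`, where `n` is any positive integer such that
`nα` is an endomorphism. Such an `n` exists (`exists_isMultiple`) and every choice gives the same
subgroup (`image_eq_range`), so the supremum below is over a one-element set. -/
def image {G : Type*} [Group G] (ρ : G →* torusEnd Λ) (α : MonoidAlgebra ℚ G) :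
    AddSubgroup (E ⧸ Λ) :=
  sSup {B | ∃ n : ℕ, 0 < n ∧ ∃ φ : torusEnd Λ, IsMultiple ρ α n φ ∧
    B = endRange φ}

variable {Λ} in
theorem exists_isMultiple {G : Type*} [Group G] (ρ : G →* torusEnd Λ) (α : MonoidAlgebra ℚ G) :
    ∃ n : ℕ, 0 < n ∧ ∃ φ : torusEnd Λ, IsMultiple ρ α n φ := by
  unfold IsMultiple
  generalize groupAlgebraHom ρ α = β
  induction β using TensorProduct.induction_on with
  | zero => exact ⟨1, one_pos, 0, by simp⟩
  | tmul q f =>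
    refine ⟨q.den, q.den_pos, q.num • f, ?_⟩
    change q.den • (q ⊗ₜ[ℤ] f) = (1 : ℚ) ⊗ₜ[ℤ] (q.num • f)
    rw [← TensorProduct.smul_tmul, TensorProduct.smul_tmul']
    congr 1
    simp
  | add x y hx hy =>
    obtain ⟨n, hn, φ, h1⟩ := hx
    obtain ⟨m, hm, ψ, h2⟩ := hy
    refine ⟨n * m, Nat.mul_pos hn hm, m • φ + n • ψ, ?_⟩
    rw [map_add, map_nsmul, map_nsmul, ← h1, ← h2, smul_add, smul_smul, smul_smul, mul_comm m n]

variable {Λ} in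
theorem image_eq_range {G : Type*} [Group G] (ρ : G →* torusEnd Λ) (α : MonoidAlgebra ℚ G)
    (n : ℕ) (hn : 0 < n) (φ : torusEnd Λ) (h : IsMultiple ρ α n φ) :
    image ρ α = endRange φ := by
  have key : ∀ (n m : ℕ) (φ ψ : torusEnd Λ), 0 < m → IsMultiple ρ α n φ →
      IsMultiple ρ α m ψ → endRange φ ≤ endRange ψ := by
    intro n m φ ψ hm h1 h2
    have e : m • φ = n • ψ := by
      apply toEndQ_injective
      rw [map_nsmul, map_nsmul, ← show _ = _ from h1, ← show _ = _ from h2, smul_smul, smul_smul,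
        mul_comm]
    rintro _ ⟨z, rfl⟩
    obtain ⟨w, rfl⟩ := divisible Λ m hm z
    refine ⟨n • w, ?_⟩
    have e' := congrArg (fun k : torusEnd Λ => (k : AddMonoid.End (E ⧸ Λ)) w) e
    rw [map_nsmul, map_nsmul]
    exact e'.symm
  apply le_antisymm
  · apply sSup_le
    rintro _ ⟨m, hm, ψ, h2, rfl⟩
    exact key _ _ _ _ hn h2 h
  · exact le_sSup ⟨n, hn, φ, h, rfl⟩

end Torus

/-! ### Elements of the rational group algebra -/

section GroupAlgebra

variable {G : Type*} [Group G] [Fintype G]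

open Classical in
/-- The idempotent `p_H = |H|⁻¹ ∑_{h ∈ H} h` of `ℚ[G]`. -/
def pIdem (H : Subgroup G) : MonoidAlgebra ℚ G :=
  (Nat.card H : ℚ)⁻¹ • ∑ g : G with g ∈ H, MonoidAlgebra.of ℚ G g

open Classical in
/-- The element `q_D = |H|⁻¹ ∑_{g ∈ D} g` of the Hecke algebra `p_H ℚ[G] p_H`, for a double coset
`D ∈ H \ G / H`. -/
def qElem (H : Subgroup G) (D : DoubleCoset.Quotient (H : Set G) (H : Set G)) :
    MonoidAlgebra ℚ G :=
  (Nat.card H : ℚ)⁻¹ • ∑ g : G with DoubleCoset.mk H H g = D, MonoidAlgebra.of ℚ G g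

variable {V : Type*} [AddCommGroup V] [Module ℂ V] (σ : Representation ℂ G V)

/-- The character `χ_V`, extended linearly to `ℚ[G]`. -/
def charValue (α : MonoidAlgebra ℚ G) : ℂ :=
  LinearMap.trace ℂ V (∑ g : G, ((α.coeff g : ℚ) : ℂ) • σ g)

/-- The field `K` generated over `ℚ` by the values of the character of `V`. -/
def charField : IntermediateField ℚ ℂ :=
  IntermediateField.adjoin ℚ (Set.range σ.character)

/-- The value `χ_V(g)` as an element of `K`. -/
def charInField (g : G) : charField σ :=
  ⟨σ.character g, IntermediateField.subset_adjoin ℚ _ ⟨g, rfl⟩⟩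

/-- The central idempotent `e_W = (dim V / |G|) ∑_g tr_{K/ℚ}(χ_V(g⁻¹)) g` of `ℚ[G]`, where `W` is
the irreducible rational representation Galois associated to `V`. -/
def eIdem : MonoidAlgebra ℚ G :=
  ((Module.finrank ℂ V : ℚ) / (Nat.card G : ℚ)) •
    ∑ g : G, Algebra.trace ℚ (charField σ) (charInField σ g⁻¹) • MonoidAlgebra.of ℚ G g

/-- The central idempotent `f_{H,W̃} = p_H e_W` of the Hecke algebra. -/
def fIdem (H : Subgroup G) : MonoidAlgebra ℚ G := pIdem H * eIdem σ

end GroupAlgebra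

/-! ### The subvarieties -/

section Subvarieties

variable {E : Type*} [NormedAddCommGroup E] [NormedSpace ℂ E] {Λ : Submodule ℤ E}
  {G : Type*} [Group G] [Fintype G] (ρ : G →* torusEnd Λ) (H : Subgroup G)
  {V : Type*} [AddCommGroup V] [Module ℂ V] (σ : Representation ℂ G V)

/-- The abelian subvariety `A_H = Im(p_H)`. -/
def subA : AddSubgroup (E ⧸ Λ) := image ρ (pIdem H)

/-- The isotypical component `A_{H,W̃} = Im(f_{H,W̃})` of `A_H`. -/
def isoComp : AddSubgroup (E ⧸ Λ) := image ρ (fIdem σ H)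

/-- The endomorphism `φ` of `A_H` is the one given by `α`: in the (torsion-free) group of
homomorphisms `A_H → A`, the restriction of an endomorphism `n α` of `A` equals `n φ`. -/
def ActsAs (α : MonoidAlgebra ℚ G) (φ : subEnd Λ (subA ρ H)) : Prop :=
  ∃ n : ℕ, 0 < n ∧ ∃ ψ : torusEnd Λ, IsMultiple ρ α n ψ ∧
    ∀ z : subA ρ H, n • (((φ : AddMonoid.End (subA ρ H)) z : subA ρ H) : E ⧸ Λ) =
      (ψ : AddMonoid.End (E ⧸ Λ)) z

/-- The set of all `z ∈ A_H` with `q_D(z) = χ_V(q_D) z` for every double coset `D`, where `q_D` is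
read as an endomorphism `φ` of `A_H` and `χ_V(q_D)` as an integer `c`. -/
def eigenLocus : Set (E ⧸ Λ) :=
  {z | ∃ hz : z ∈ subA ρ H, ∀ D : DoubleCoset.Quotient (H : Set G) (H : Set G),
    ∃ (φ : subEnd Λ (subA ρ H)) (c : ℤ), ActsAs ρ H (qElem H D) φ ∧
      charValue σ (qElem H D) = c ∧
      (((φ : AddMonoid.End (subA ρ H)) ⟨z, hz⟩ : subA ρ H) : E ⧸ Λ) = c • z}

/-- `B_{H,W̃}`, the connected component of the above set that contains `0`. -/
def eigenComp : Set (E ⧸ Λ) := connectedComponentIn (eigenLocus ρ H σ) 0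

end Subvarieties

end HeckeAV

end

/-! Write N for the sum over H, C_D for the sum over a double coset D, and R_D for the sum over left
coset representatives in D, so that R_D N = C_D (`repSum_mul_subgroupSum`). On A_H, the image of N,
the integral element R_D therefore satisfies |H| R_D = C_D and preserves A_H; it is the endomorphism
induced by q_D, unique because A_H is divisible.

On V the image of N is the line V^H, so C_D = μ N with μ the eigenvalue of R_D there
(`exists_eigenvalue`). Then χ_V(q_D) = μ is an algebraic integer, and rational since K = ℚ; hence it
is an integer c_D.

An element of ℚ[G] that kills V kills e_W (`mul_eIdem_eq_zero`). Applied to C_D - c_D N, this shows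
that q_D acts as c_D on the image of f = p_H e_W. That image is connected and contains 0, so it lies
in the component.

Conversely, f has coefficients constant on double cosets, so a multiple nf with integral
coefficients is a combination of the C_D. It acts on an eigenpoint z as an integer computed from the
c_D alone, and the same expression computes its trace on V, which is n χ_V(f) = n (`sum_smul_apply`,
`charValue_fIdem`). Thus nz lies in the image for each z in the component, which is thereby covered
by finitely many closed torsion translates of the image; connectedness leaves only the image itself
(`subset_endRange_of_isPreconnected`). -/

namespace HeckeAV

/-! ### Sums over subgroups and double cosets in a ring -/

section GroupSums

variable {G : Type*} [Group G] [Fintype G] {R : Type*} [Ring R] (τ : G →* R) (H : Subgroup G)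

open Classical in
/-- The sum of the values of `τ` over the subgroup `H`. -/
noncomputable def subgroupSum : R := ∑ g : G with g ∈ H, τ g

open Classical in
/-- The sum of the values of `τ` over the double coset `D`. -/
noncomputable def cosetSum (D : DoubleCoset.Quotient (H : Set G) (H : Set G)) : R :=
  ∑ g : G with DoubleCoset.mk H H g = D, τ g

open Classical in
/-- The sum of the values of `τ` over representatives of the left cosets of `H` contained in the
double coset `D`. -/
noncomputable def repSum (D : DoubleCoset.Quotient (H : Set G) (H : Set G)) : R :=
  ∑ c : G ⧸ H with DoubleCoset.mk H H c.out = D, τ c.out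

omit [Fintype G] in
variable {H} in
theorem mk_mul_right (g : G) {h : G} (hh : h ∈ H) :
    DoubleCoset.mk H H (g * h) = DoubleCoset.mk H H g :=
  ((DoubleCoset.eq H H _ _).2 ⟨1, H.one_mem, h, hh, by simp⟩).symm

omit [Fintype G] in
variable {H} in
theorem mk_mul_left (g : G) {h : G} (hh : h ∈ H) :
    DoubleCoset.mk H H (h * g) = DoubleCoset.mk H H g :=
  ((DoubleCoset.eq H H _ _).2 ⟨h, hh, 1, H.one_mem, by simp⟩).symm

variable {H} in
theorem mul_subgroupSum {h : G} (hh : h ∈ H) : τ h * subgroupSum τ H = subgroupSum τ H := by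
  classical
  rw [subgroupSum, Finset.mul_sum]
  refine Finset.sum_equiv (Equiv.mulLeft h) (fun g => ?_) (fun g _ => by simp)
  simp [H.mul_mem_cancel_left hh]

variable {H} in
theorem subgroupSum_mul {h : G} (hh : h ∈ H) : subgroupSum τ H * τ h = subgroupSum τ H := by
  classical
  rw [subgroupSum, Finset.sum_mul]
  refine Finset.sum_equiv (Equiv.mulRight h) (fun g => ?_) (fun g _ => by simp)
  simp [H.mul_mem_cancel_right hh]

variable {H} in
theorem mul_cosetSum (D : DoubleCoset.Quotient (H : Set G) (H : Set G)) {h : G} (hh : h ∈ H) :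
    τ h * cosetSum τ H D = cosetSum τ H D := by
  classical
  rw [cosetSum, Finset.mul_sum]
  refine Finset.sum_equiv (Equiv.mulLeft h) (fun g => ?_) (fun g _ => by simp)
  simp [mk_mul_left g hh]

variable {H} in
theorem cosetSum_mul (D : DoubleCoset.Quotient (H : Set G) (H : Set G)) {h : G} (hh : h ∈ H) :
    cosetSum τ H D * τ h = cosetSum τ H D := by
  classical
  rw [cosetSum, Finset.sum_mul]
  refine Finset.sum_equiv (Equiv.mulRight h) (fun g => ?_) (fun g _ => by simp)
  simp [mk_mul_right g hh]

theorem card_filter_mem [DecidablePred (· ∈ H)] :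
    (Finset.univ.filter (· ∈ H)).card = Nat.card H := by
  rw [Nat.card_eq_fintype_card, Fintype.card_subtype]

theorem subgroupSum_mul_eq {x : R} (hx : ∀ h ∈ H, τ h * x = x) :
    subgroupSum τ H * x = Nat.card H • x := by
  classical
  rw [subgroupSum, Finset.sum_mul, Finset.sum_congr rfl (g := fun _ => x)
    (fun g hg => hx g (by simpa using hg)), Finset.sum_const, card_filter_mem]

theorem mul_subgroupSum_eq {x : R} (hx : ∀ h ∈ H, x * τ h = x) :
    x * subgroupSum τ H = Nat.card H • x := by
  classical
  rw [subgroupSum, Finset.mul_sum, Finset.sum_congr rfl (g := fun _ => x)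
    (fun g hg => hx g (by simpa using hg)), Finset.sum_const, card_filter_mem]

omit [Fintype G] in
theorem bijective_out_mul :
    Function.Bijective (fun p : (G ⧸ H) × H => p.1.out * (p.2 : G)) := by
  constructor
  · rintro ⟨c, h⟩ ⟨c', h'⟩ e
    have e' : c.out * (h : G) = c'.out * (h' : G) := e
    have hc : c = c' := by
      have := congrArg (QuotientGroup.mk (s := H)) e'
      simpa [QuotientGroup.mk_mul_of_mem _ h.2, QuotientGroup.mk_mul_of_mem _ h'.2] using this
    subst hc
    exact Prod.ext rfl (Subtype.ext (mul_left_cancel e'))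
  · intro g
    refine ⟨((g : G ⧸ H), ⟨(g : G ⧸ H).out⁻¹ * g, ?_⟩), by simp⟩
    rw [← QuotientGroup.eq, QuotientGroup.out_eq']

/-- Every g is uniquely a representative times an element of H, and D is stable under right
multiplication by H. This factorization removes the denominator |H| from q_D on the image of the
subgroup sum. -/
theorem repSum_mul_subgroupSum (D : DoubleCoset.Quotient (H : Set G) (H : Set G)) :
    repSum τ H D * subgroupSum τ H = cosetSum τ H D := by
  classical
  have hN : subgroupSum τ H = ∑ h : H, τ h := by
    rw [subgroupSum, Finset.sum_subtype (p := (· ∈ H))]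
    simp
  rw [hN, cosetSum, Finset.sum_filter, ← (bijective_out_mul H).sum_comp, Fintype.sum_prod_type,
    repSum, Finset.sum_filter, Finset.sum_mul]
  refine Finset.sum_congr rfl fun c _ => ?_
  rw [Finset.mul_sum]
  refine Finset.sum_congr rfl fun h _ => ?_
  rw [mk_mul_right _ h.2, map_mul, ite_mul, zero_mul]

theorem subgroupSum_mul_cosetSum (D : DoubleCoset.Quotient (H : Set G) (H : Set G)) :
    subgroupSum τ H * cosetSum τ H D = Nat.card H • cosetSum τ H D :=
  subgroupSum_mul_eq τ H fun _ => mul_cosetSum τ D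

theorem cosetSum_mul_subgroupSum (D : DoubleCoset.Quotient (H : Set G) (H : Set G)) :
    cosetSum τ H D * subgroupSum τ H = Nat.card H • cosetSum τ H D :=
  mul_subgroupSum_eq τ H fun _ => cosetSum_mul τ D

theorem subgroupSum_mul_self :
    subgroupSum τ H * subgroupSum τ H = Nat.card H • subgroupSum τ H :=
  subgroupSum_mul_eq τ H fun _ => mul_subgroupSum τ

theorem map_cosetSum {S : Type*} [Ring S] (F : R →+* S)
    (D : DoubleCoset.Quotient (H : Set G) (H : Set G)) :
    F (cosetSum τ H D) = cosetSum ((F : R →* S).comp τ) H D := by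
  simp [cosetSum]

theorem map_subgroupSum {S : Type*} [Ring S] (F : R →+* S) :
    F (subgroupSum τ H) = subgroupSum ((F : R →* S).comp τ) H := by
  simp [subgroupSum]

theorem map_repSum {S : Type*} [Ring S] (F : R →+* S)
    (D : DoubleCoset.Quotient (H : Set G) (H : Set G)) :
    F (repSum τ H D) = repSum ((F : R →* S).comp τ) H D := by
  simp [repSum]

/-- A sum over `G` with coefficients constant on double cosets is a combination of the sums over
the double cosets. -/
theorem sum_smul_eq [Fintype (DoubleCoset.Quotient (H : Set G) (H : Set G))] {k : G → ℤ}
    (hkc : ∀ g g', DoubleCoset.mk H H g = DoubleCoset.mk H H g' → k g = k g') :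
    ∑ g, k g • τ g = ∑ D : DoubleCoset.Quotient (H : Set G) (H : Set G),
      k (Quotient.out D) • cosetSum τ H D := by
  classical
  rw [← Finset.sum_fiberwise Finset.univ (DoubleCoset.mk H H)]
  refine Finset.sum_congr rfl fun D _ => ?_
  rw [cosetSum, Finset.smul_sum]
  refine Finset.sum_congr rfl fun g hg => ?_
  rw [hkc g (Quotient.out D) (by simpa [DoubleCoset.out_eq'] using hg)]

theorem pIdem_eq : pIdem H = (Nat.card H : ℚ)⁻¹ • subgroupSum (MonoidAlgebra.of ℚ G) H := rfl

theorem qElem_eq (D : DoubleCoset.Quotient (H : Set G) (H : Set G)) :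
    qElem H D = (Nat.card H : ℚ)⁻¹ • cosetSum (MonoidAlgebra.of ℚ G) H D := rfl

theorem card_smul_pIdem : Nat.card H • pIdem H = subgroupSum (MonoidAlgebra.of ℚ G) H := by
  rw [pIdem_eq, ← Nat.cast_smul_eq_nsmul ℚ, smul_smul, mul_inv_cancel₀, one_smul]
  exact_mod_cast Nat.card_pos.ne'

theorem card_smul_qElem (D : DoubleCoset.Quotient (H : Set G) (H : Set G)) :
    Nat.card H • qElem H D = cosetSum (MonoidAlgebra.of ℚ G) H D := by
  rw [qElem_eq, ← Nat.cast_smul_eq_nsmul ℚ, smul_smul, mul_inv_cancel₀, one_smul]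
  exact_mod_cast Nat.card_pos.ne'

theorem qElem_mul_pIdem (D : DoubleCoset.Quotient (H : Set G) (H : Set G)) :
    qElem H D * pIdem H = qElem H D := by
  rw [pIdem_eq, qElem_eq, smul_mul_smul_comm, cosetSum_mul_subgroupSum,
    ← Nat.cast_smul_eq_nsmul ℚ, smul_smul, mul_assoc, inv_mul_cancel₀, mul_one]
  exact_mod_cast Nat.card_pos.ne'

theorem pIdem_mul_self : pIdem H * pIdem H = pIdem H := by
  rw [pIdem_eq, smul_mul_smul_comm, subgroupSum_mul_self,
    ← Nat.cast_smul_eq_nsmul ℚ, smul_smul, mul_assoc, inv_mul_cancel₀, mul_one]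
  exact_mod_cast Nat.card_pos.ne'

end GroupSums

/-! ### Topology of complex tori -/

section Topology

variable {E : Type*} [NormedAddCommGroup E] [NormedSpace ℂ E] (Λ : Submodule ℤ E)

theorem IsHolomorphic.continuous {Λ : Submodule ℤ E} {f : E ⧸ Λ → E ⧸ Λ}
    (hf : IsHolomorphic Λ f) : Continuous f := by
  rw [← Λ.isOpenQuotientMap_mkQ.continuous_comp_iff, continuous_iff_continuousAt]
  intro x
  obtain ⟨φ, hφ, h⟩ := hf x
  have hc : ContinuousAt (Λ.mkQ ∘ φ) x :=
    Λ.isOpenQuotientMap_mkQ.continuous.continuousAt.comp hφ.continuousAt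
  exact hc.congr (by filter_upwards [h] with y hy using hy.symm)

theorem torusEnd_continuous {Λ : Submodule ℤ E} (θ : torusEnd Λ) :
    Continuous (θ : AddMonoid.End (E ⧸ Λ)) :=
  IsHolomorphic.continuous θ.2

theorem isPreconnected_endRange {Λ : Submodule ℤ E} (θ : torusEnd Λ) :
    IsPreconnected (endRange θ : Set (E ⧸ Λ)) := by
  have : PreconnectedSpace (E ⧸ Λ) := by
    have := isPreconnected_range Λ.isOpenQuotientMap_mkQ.continuous
    rw [Λ.mkQ_surjective.range_eq] at this
    exact ⟨this⟩
  exact isPreconnected_range (torusEnd_continuous θ)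

omit [NormedSpace ℂ E] in
theorem torus_t2Space [DiscreteTopology Λ] : T2Space (E ⧸ Λ) := by
  have : IsClosed (Λ : Set E) := AddSubgroup.isClosed_of_discrete (H := Λ.toAddSubgroup)
  have : T3Space (E ⧸ Λ) := Submodule.t3_quotient_of_isClosed Λ
  infer_instance

variable [FiniteDimensional ℂ E] [DiscreteTopology Λ] [IsZLattice ℝ Λ]

theorem torus_compactSpace : CompactSpace (E ⧸ Λ) := by
  have : FiniteDimensional ℝ E := FiniteDimensional.complexToReal E
  have h := IsZLattice.isCompact_range_of_periodic Λ Λ.mkQ Λ.isOpenQuotientMap_mkQ.continuous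
    (fun z w hw => by simpa using hw)
  rw [Λ.mkQ_surjective.range_eq] at h
  exact ⟨h⟩

theorem isClosed_endRange {Λ : Submodule ℤ E} [DiscreteTopology Λ] [IsZLattice ℝ Λ]
    (θ : torusEnd Λ) : IsClosed (endRange θ : Set (E ⧸ Λ)) := by
  have := torus_compactSpace Λ
  have := torus_t2Space Λ
  exact (isCompact_range (torusEnd_continuous θ)).isClosed

/-- The n-torsion is n⁻¹Λ/Λ, a finitely generated abelian group killed by n. -/
theorem finite_torsion (n : ℕ) (hn : 0 < n) : {t : E ⧸ Λ | n • t = 0}.Finite := by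
  have : FiniteDimensional ℝ E := FiniteDimensional.complexToReal E
  have : Module.Finite ℤ Λ := ZLattice.module_finite ℝ Λ
  have hn' : (n : ℂ) ≠ 0 := by exact_mod_cast hn.ne'
  let j : Λ →ₗ[ℤ] E ⧸ Λ :=
    Λ.mkQ ∘ₗ (DistribSMul.toLinearMap ℤ E (n : ℂ)⁻¹) ∘ₗ Λ.subtype
  have hj : ∀ x : Λ, j x = Λ.mkQ ((n : ℂ)⁻¹ • (x : E)) := fun _ => rfl
  have hnj : ∀ x : Λ, n • j x = 0 := fun x => by
    rw [hj, ← map_nsmul, ← Nat.cast_smul_eq_nsmul ℂ, smul_smul, mul_inv_cancel₀ hn', one_smul]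
    exact (Submodule.Quotient.mk_eq_zero Λ).2 x.2
  have : Finite (LinearMap.range j) := by
    refine Module.finite_of_fg_torsion _ ?_
    rintro ⟨_, x, rfl⟩
    refine ⟨⟨(n : ℤ), by simpa using hn.ne'⟩, Subtype.ext ?_⟩
    change (n : ℤ) • j x = 0
    rw [natCast_zsmul, hnj]
  refine (Set.toFinite (LinearMap.range j : Set (E ⧸ Λ))).subset fun t ht => ?_
  obtain ⟨x, rfl⟩ := Λ.mkQ_surjective t
  have hx : n • x ∈ Λ := by
    rw [← Submodule.Quotient.mk_eq_zero, ← Submodule.mkQ_apply, map_nsmul]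
    exact ht
  refine ⟨⟨n • x, hx⟩, ?_⟩
  rw [hj]
  congr 1
  change (n : ℂ)⁻¹ • (n • x) = x
  rw [← Nat.cast_smul_eq_nsmul ℂ, smul_smul, inv_mul_cancel₀ hn', one_smul]

/-- A connected set of points having a fixed multiple in the image of an endomorphism lies in that
image as soon as it contains `0`. -/
theorem subset_endRange_of_isPreconnected {Λ : Submodule ℤ E} [DiscreteTopology Λ]
    [IsZLattice ℝ Λ] (θ : torusEnd Λ) {C : Set (E ⧸ Λ)} (hC : IsPreconnected C)
    (h0 : (0 : E ⧸ Λ) ∈ C) {n : ℕ} (hn : 0 < n) (hmul : ∀ z ∈ C, n • z ∈ endRange θ) :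
    C ⊆ (endRange θ : Set (E ⧸ Λ)) := by
  let B : Set (E ⧸ Λ) := SetLike.coe (endRange θ)
  have hcl : IsClosed B := isClosed_endRange θ
  -- Only torsion points outside the image are used, so that the translates forming `U` are disjoint
  -- from `B`.
  let T : Set (E ⧸ Λ) := {t | n • t = 0 ∧ t ∉ endRange θ}
  have hT : T.Finite := (finite_torsion Λ n hn).subset fun t ht => ht.1
  let U : Set (E ⧸ Λ) := ⋃ t ∈ T, (fun z => z - t) ⁻¹' B
  have hU : IsClosed U := hT.isClosed_biUnion fun t _ =>
    hcl.preimage (continuous_id.sub continuous_const)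
  have hdisj : ∀ z ∈ B, z ∉ U := by
    intro z hz hzU
    simp only [U, Set.mem_iUnion, Set.mem_preimage] at hzU
    obtain ⟨t, ht, hzt⟩ := hzU
    refine ht.2 ?_
    have := (endRange θ).sub_mem hz hzt
    simpa using this
  have hcov : C ⊆ B ∪ U := by
    intro z hz
    obtain ⟨w, hw⟩ : n • z ∈ Set.range (θ : AddMonoid.End (E ⧸ Λ)) := hmul z hz
    obtain ⟨w', rfl⟩ := divisible Λ n hn w
    by_cases hzB : z ∈ endRange θ
    · exact Or.inl hzB
    · refine Or.inr ?_
      have hw'B : (θ : AddMonoid.End (E ⧸ Λ)) w' ∈ endRange θ := ⟨w', rfl⟩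
      simp only [U, Set.mem_iUnion, Set.mem_preimage]
      -- From nz = θ(nw') the difference z - θ(w') is n-torsion, and it lies outside the image
      -- because z does.
      refine ⟨z - (θ : AddMonoid.End (E ⧸ Λ)) w', ⟨?_, fun h => hzB ?_⟩, ?_⟩
      · rw [smul_sub, ← hw, map_nsmul, sub_self]
      · simpa using (endRange θ).add_mem h hw'B
      · simpa [B] using hw'B
  rcases isPreconnected_iff_subset_of_disjoint_closed.1 hC B U hcl hU hcov
    (by
      rw [Set.eq_empty_iff_forall_notMem]
      rintro z ⟨_, hzB, hzU⟩
      exact hdisj z hzB hzU) with h | h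
  · exact h
  · exact absurd (h h0) (hdisj 0 (endRange θ).zero_mem)

end Topology

/-! ### The representation `V` -/

section Coefficients

variable {G : Type*} [Group G] [Fintype G] {V : Type*} [AddCommGroup V] [Module ℂ V]
  (σ : Representation ℂ G V) (H : Subgroup G)

/-- The action of `ℚ[G]` on a complex representation of `G`. -/
noncomputable def ratAction : MonoidAlgebra ℚ G →+* Module.End ℂ V :=
  (σ.asAlgebraHom : MonoidAlgebra ℂ G →+* Module.End ℂ V).comp
    (MonoidAlgebra.mapRingHom G (algebraMap ℚ ℂ))

omit [Fintype G] in
theorem ratAction_of (g : G) : ratAction σ (MonoidAlgebra.of ℚ G g) = σ g := by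
  simp [ratAction]

omit [Fintype G] in
theorem ratAction_smul (q : ℚ) (α : MonoidAlgebra ℚ G) :
    ratAction σ (q • α) = (q : ℂ) • ratAction σ α := by
  have : q • α = MonoidAlgebra.single 1 q * α := by
    ext g
    simp
  rw [this, map_mul]
  simp [ratAction]

theorem eq_sum_coeff (α : MonoidAlgebra ℚ G) :
    α = ∑ g : G, α.coeff g • MonoidAlgebra.of ℚ G g := by
  classical
  ext g
  simp [MonoidAlgebra.coeff_sum]

theorem ratAction_apply (α : MonoidAlgebra ℚ G) :
    ratAction σ α = ∑ g : G, ((α.coeff g : ℚ) : ℂ) • σ g := by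
  conv_lhs => rw [eq_sum_coeff α]
  rw [map_sum]
  exact Finset.sum_congr rfl fun g _ => by rw [ratAction_smul, ratAction_of]

theorem charValue_eq (α : MonoidAlgebra ℚ G) :
    charValue σ α = LinearMap.trace ℂ V (ratAction σ α) := by
  rw [ratAction_apply, charValue]

theorem charValue_eq_sum (α : MonoidAlgebra ℚ G) :
    charValue σ α = ∑ g : G, ((α.coeff g : ℚ) : ℂ) * σ.character g := by
  rw [charValue, map_sum]
  simp [Representation.character]

theorem coeff_mul_sum (α β : MonoidAlgebra ℚ G) (g : G) :
    (α * β).coeff g = ∑ h : G, α.coeff h * β.coeff (h⁻¹ * g) := by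
  rw [MonoidAlgebra.coeff_mul_apply_left, Finsupp.sum_fintype _ _ (by simp)]

theorem coeff_eIdem_eq (g : G) : (eIdem σ).coeff g =
    ((Module.finrank ℂ V : ℚ) / (Nat.card G : ℚ)) *
      Algebra.trace ℚ (charField σ) (charInField σ g⁻¹) := by
  classical
  rw [eIdem, MonoidAlgebra.coeff_smul_apply, MonoidAlgebra.coeff_sum]
  simp [Finsupp.single_apply]

/-- The coefficients form a class function, because the character does. -/
theorem eIdem_central (g : G) :
    MonoidAlgebra.of ℚ G g * eIdem σ = eIdem σ * MonoidAlgebra.of ℚ G g := by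
  ext x
  rw [MonoidAlgebra.of_apply, MonoidAlgebra.coeff_single_mul_apply,
    MonoidAlgebra.coeff_mul_single_apply, coeff_eIdem_eq, coeff_eIdem_eq, one_mul, mul_one]
  congr 2
  apply Subtype.ext
  change σ.character _ = σ.character _
  rw [← σ.char_conj (g⁻¹ * x)⁻¹ g]
  congr 1
  group

variable {σ}

omit [Fintype G] in
theorem exists_rat_character (hK : charField σ = ⊥) (g : G) :
    ∃ r : ℚ, (r : ℂ) = σ.character g := by
  have h : σ.character g ∈ charField σ := (charInField σ g).2
  rw [hK] at h
  obtain ⟨r, hr⟩ := IntermediateField.mem_bot.1 h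
  exact ⟨r, hr⟩

omit [Fintype G] in
theorem trace_charInField (hK : charField σ = ⊥) (g : G) :
    ((Algebra.trace ℚ (charField σ) (charInField σ g) : ℚ) : ℂ) = σ.character g := by
  obtain ⟨r, hr⟩ := exists_rat_character hK g
  have h : charInField σ g = algebraMap ℚ (charField σ) r := Subtype.ext hr.symm
  have h1 : Module.finrank ℚ (charField σ) = 1 := by
    rw [hK, IntermediateField.finrank_bot]
  rw [h, Algebra.trace_algebraMap, h1, one_smul, hr]

theorem coeff_eIdem (hK : charField σ = ⊥) (g : G) : (((eIdem σ).coeff g : ℚ) : ℂ) =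
    ((Module.finrank ℂ V : ℂ) / (Nat.card G : ℂ)) * σ.character g⁻¹ := by
  rw [coeff_eIdem_eq, Rat.cast_mul, trace_charInField hK]
  simp

/-- Elements of `ℚ[G]` acting as zero on `V` annihilate the central idempotent. -/
theorem mul_eIdem_eq_zero (hK : charField σ = ⊥) (α : MonoidAlgebra ℚ G)
    (h : ratAction σ α = 0) : α * eIdem σ = 0 := by
  ext g
  rw [← Rat.cast_inj (α := ℂ), coeff_mul_sum, Rat.cast_sum]
  have h1 : LinearMap.trace ℂ V (ratAction σ α * σ g⁻¹) = 0 := by rw [h, zero_mul, map_zero]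
  rw [ratAction_apply, Finset.sum_mul, map_sum] at h1
  -- Termwise, the coefficient of the product at g is (dim V/|G|) times the trace of the action of α
  -- composed with g⁻¹, which vanishes.
  have h2 : ∀ x : G, (((α.coeff x * (eIdem σ).coeff (x⁻¹ * g) : ℚ)) : ℂ) =
      ((Module.finrank ℂ V : ℂ) / (Nat.card G : ℂ)) *
        LinearMap.trace ℂ V ((((α.coeff x : ℚ) : ℂ) • σ x) * σ g⁻¹) := by
    intro x
    rw [Rat.cast_mul, coeff_eIdem hK, smul_mul_assoc, map_smul, ← map_mul, mul_inv_rev, inv_inv,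
      σ.char_mul_comm, Representation.character, smul_eq_mul]
    ring
  rw [Finset.sum_congr rfl fun x _ => h2 x, ← Finset.mul_sum, h1]
  simp

variable [FiniteDimensional ℂ V]

/-- Schur's lemma makes the central element a scalar, and orthonormality of characters gives it
trace dim V, so the scalar is 1. -/
theorem ratAction_eIdem (hirr : σ.IsIrreducible) (hK : charField σ = ⊥)
    (hd : Module.finrank ℂ V ≠ 0) : ratAction σ (eIdem σ) = 1 := by
  have hcomm : ∀ g, ratAction σ (eIdem σ) * σ g = σ g * ratAction σ (eIdem σ) := by
    intro g
    rw [← ratAction_of, ← map_mul, ← map_mul, eIdem_central]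
  let T : Representation.IntertwiningMap σ σ :=
    { toLinearMap := ratAction σ (eIdem σ)
      isIntertwining' := fun g => hcomm g }
  obtain ⟨μ, hμ⟩ :=
    (Representation.IsIrreducible.algebraMap_intertwiningMap_bijective_of_isAlgClosed
      (ρ := σ)).2 T
  have hμ' : ratAction σ (eIdem σ) = μ • (1 : Module.End ℂ V) := by
    ext v
    have := congrArg (fun S : Representation.IntertwiningMap σ σ => S v) hμ
    exact this.symm
  have htr : LinearMap.trace ℂ V (ratAction σ (eIdem σ)) = Module.finrank ℂ V := by
    rw [← charValue_eq, charValue_eq_sum]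
    have : Invertible (Nat.card G : ℂ) := invertibleOfNonzero (by exact_mod_cast Nat.card_pos.ne')
    have ho := Representation.char_orthonormal σ σ
    rw [if_pos ⟨Representation.Equiv.refl σ⟩] at ho
    simp_rw [coeff_eIdem hK]
    refine Eq.trans ?_ ((congrArg ((Module.finrank ℂ V : ℂ) * ·) ho).trans (mul_one _))
    rw [Finset.mul_sum, Finset.mul_sum]
    refine Finset.sum_congr rfl fun g _ => ?_
    ring
  rw [hμ', map_smul, LinearMap.trace_one, smul_eq_mul] at htr
  have hd' : (Module.finrank ℂ V : ℂ) ≠ 0 := by exact_mod_cast hd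
  have : μ = 1 := mul_right_cancel₀ hd' (by rw [htr, one_mul])
  rw [hμ', this, one_smul]

end Coefficients

/-! ### Integrality of the Hecke eigenvalues on the line of invariants -/

section Eigenvalues

variable {G : Type*} [Group G] [Fintype G] {V : Type*} [AddCommGroup V] [Module ℂ V]
  (σ : Representation ℂ G V) (H : Subgroup G)

omit [Fintype G] in
theorem mem_invariants_of_subgroup {v : V} (h : ∀ g ∈ H, σ g v = v) :
    v ∈ Representation.invariants (σ.comp H.subtype) := fun g => h g g.2

theorem map_of_cosetSum (D : DoubleCoset.Quotient (H : Set G) (H : Set G)) :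
    ratAction σ (cosetSum (MonoidAlgebra.of ℚ G) H D) = cosetSum σ H D := by
  rw [map_cosetSum]
  congr 1
  ext1 g
  exact ratAction_of σ g

theorem map_of_subgroupSum :
    ratAction σ (subgroupSum (MonoidAlgebra.of ℚ G) H) = subgroupSum σ H := by
  rw [map_subgroupSum]
  congr 1
  ext1 g
  exact ratAction_of σ g

/-- The operator comes from ℤ[G], which is a finite ℤ-module. -/
theorem isIntegral_repSum (D : DoubleCoset.Quotient (H : Set G) (H : Set G)) :
    IsIntegral ℤ (repSum σ H D) := by
  have h := (IsIntegral.of_finite ℤ (repSum (MonoidAlgebra.of ℤ G) H D)).map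
    (MonoidAlgebra.lift ℤ (Module.End ℂ V) G σ)
  have e := map_repSum (MonoidAlgebra.of ℤ G) H
    (MonoidAlgebra.lift ℤ (Module.End ℂ V) G σ : MonoidAlgebra ℤ G →+* Module.End ℂ V) D
  have e2 : ((MonoidAlgebra.lift ℤ (Module.End ℂ V) G σ :
      MonoidAlgebra ℤ G →+* Module.End ℂ V) : MonoidAlgebra ℤ G →* Module.End ℂ V).comp
      (MonoidAlgebra.of ℤ G) = σ := by
    ext1 g
    simp
  rw [e2] at e
  rw [← e]
  exact h

theorem isIntegral_of_eigenvector {X : Module.End ℂ V} (hX : IsIntegral ℤ X) {μ : ℂ} {v : V}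
    (hv : v ≠ 0) (h : X v = μ • v) : IsIntegral ℤ μ := by
  obtain ⟨P, hP, hPX⟩ := hX
  refine ⟨P, hP, ?_⟩
  have hev : X.HasEigenvector μ v := ⟨Module.End.mem_eigenspace_iff.2 h, hv⟩
  have h1 := Module.End.aeval_apply_of_hasEigenvector (p := P.map (algebraMap ℤ ℂ)) hev
  rw [Polynomial.aeval_map_algebraMap, Polynomial.aeval_def, hPX, LinearMap.zero_apply,
    Polynomial.eval_map] at h1
  exact (smul_eq_zero.1 h1.symm).resolve_right hv

theorem trace_subgroupSum [FiniteDimensional ℂ V] :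
    LinearMap.trace ℂ V (subgroupSum σ H) =
      (Nat.card H : ℂ) * Module.finrank ℂ (Representation.invariants (σ.comp H.subtype)) := by
  classical
  have hc : (Nat.card H : ℂ) ≠ 0 := by exact_mod_cast Nat.card_pos.ne'
  have : Invertible (Nat.card H : ℂ) := invertibleOfNonzero hc
  have h := Representation.card_inv_mul_sum_char_eq_finrank (σ.comp H.subtype)
  rw [← h, mul_inv_cancel_left₀ hc, subgroupSum, map_sum, Finset.sum_subtype (p := (· ∈ H))]
  · rfl
  · simp

variable {σ H}

/-- On a representation with a one-dimensional space of `H`-invariants, the sum over a double coset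
is a multiple of the sum over `H`, by an algebraic integer. -/
theorem exists_eigenvalue
    (hdim : Module.finrank ℂ (Representation.invariants (σ.comp H.subtype)) = 1)
    (D : DoubleCoset.Quotient (H : Set G) (H : Set G)) :
    ∃ μ : ℂ, IsIntegral ℤ μ ∧ cosetSum σ H D = μ • subgroupSum σ H := by
  have hc : (Nat.card H : ℂ) ≠ 0 := by exact_mod_cast Nat.card_pos.ne'
  obtain ⟨⟨v, hv⟩, hv0, hspan⟩ := finrank_eq_one_iff'.1 hdim
  have hv0' : v ≠ 0 := fun h => hv0 (Subtype.ext h)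
  have hspan' : ∀ w : V, (∀ g ∈ H, σ g w = w) → ∃ c : ℂ, c • v = w := fun w hw => by
    obtain ⟨c, hc⟩ := hspan ⟨w, mem_invariants_of_subgroup σ H hw⟩
    exact ⟨c, congrArg Subtype.val hc⟩
  have hN : subgroupSum σ H v = (Nat.card H : ℂ) • v := by
    classical
    rw [subgroupSum, LinearMap.sum_apply, Finset.sum_congr rfl (g := fun _ => v)
      (fun g hg => hv ⟨g, by simpa using hg⟩), Finset.sum_const, card_filter_mem,
      Nat.cast_smul_eq_nsmul]
  obtain ⟨μ', hμ'⟩ := hspan' (cosetSum σ H D v) fun g hg => by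
    rw [← Module.End.mul_apply, mul_cosetSum σ D hg]
  -- The subgroup sum multiplies v by |H|, so the factorization of the coset sum gives the action of
  -- the representatives on v.
  have hX : repSum σ H D v = ((Nat.card H : ℂ)⁻¹ * μ') • v := by
    rw [mul_smul, hμ', ← repSum_mul_subgroupSum, Module.End.mul_apply, hN, map_smul,
      inv_smul_smul₀ hc]
  refine ⟨_, isIntegral_of_eigenvector (isIntegral_repSum σ H D) hv0' hX, ?_⟩
  ext w
  obtain ⟨a, ha⟩ := hspan' (subgroupSum σ H w) fun g hg => by
    rw [← Module.End.mul_apply, mul_subgroupSum σ hg]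
  rw [← repSum_mul_subgroupSum, Module.End.mul_apply, LinearMap.smul_apply, ← ha, map_smul, hX,
    smul_comm]

variable [FiniteDimensional ℂ V]

omit [FiniteDimensional ℂ V] in
theorem charValue_qElem (D : DoubleCoset.Quotient (H : Set G) (H : Set G)) :
    charValue σ (qElem H D) = (Nat.card H : ℂ)⁻¹ * LinearMap.trace ℂ V (cosetSum σ H D) := by
  rw [charValue_eq, qElem_eq, ratAction_smul, map_of_cosetSum, map_smul]
  simp

/-- The character value `χ_V(q_D)` is an integer, and `q_D` acts on `V` as this multiple of
`p_H`. -/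
theorem exists_int_eigenvalue (hK : charField σ = ⊥)
    (hdim : Module.finrank ℂ (Representation.invariants (σ.comp H.subtype)) = 1)
    (D : DoubleCoset.Quotient (H : Set G) (H : Set G)) :
    ∃ c : ℤ, charValue σ (qElem H D) = c ∧ cosetSum σ H D = c • subgroupSum σ H := by
  have hc : (Nat.card H : ℂ) ≠ 0 := by exact_mod_cast Nat.card_pos.ne'
  obtain ⟨μ, hint, hμ⟩ := exists_eigenvalue hdim D
  have hval : charValue σ (qElem H D) = μ := by
    rw [charValue_qElem, hμ, map_smul, trace_subgroupSum, hdim, smul_eq_mul, Nat.cast_one, mul_one,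
      mul_comm, mul_assoc, mul_inv_cancel₀ hc, mul_one]
  choose r hr using exists_rat_character hK
  have hrat : algebraMap ℚ ℂ (∑ g : G, (qElem H D).coeff g * r g) = μ := by
    rw [← hval, charValue_eq_sum, map_sum]
    refine Finset.sum_congr rfl fun g _ => ?_
    rw [map_mul, ← hr]
    rfl
  -- A rational algebraic integer is an integer.
  rw [← hrat, isIntegral_algebraMap_iff (algebraMap ℚ ℂ).injective,
    IsIntegrallyClosed.isIntegral_iff] at hint
  obtain ⟨c, hc'⟩ := hint
  have hcμ : μ = c := by
    rw [← hrat, ← hc']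
    simp
  refine ⟨c, hval.trans hcμ, ?_⟩
  rw [hμ, hcμ, Int.cast_smul_eq_zsmul]

omit [FiniteDimensional ℂ V] in
theorem cosetSum_mul_fIdem (hK : charField σ = ⊥) {D : DoubleCoset.Quotient (H : Set G) (H : Set G)}
    {c : ℤ} (hc : cosetSum σ H D = c • subgroupSum σ H) :
    cosetSum (MonoidAlgebra.of ℚ G) H D * fIdem σ H =
      ((Nat.card H : ℤ) * c) • fIdem σ H := by
  have h0 : (cosetSum (MonoidAlgebra.of ℚ G) H D - c • subgroupSum (MonoidAlgebra.of ℚ G) H) *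
      eIdem σ = 0 := by
    apply mul_eIdem_eq_zero hK
    rw [map_sub, map_zsmul, map_of_cosetSum, map_of_subgroupSum, hc, sub_self]
  rw [sub_mul, sub_eq_zero] at h0
  have h1 : cosetSum (MonoidAlgebra.of ℚ G) H D * pIdem H =
      cosetSum (MonoidAlgebra.of ℚ G) H D := by
    rw [← card_smul_qElem, smul_mul_assoc, qElem_mul_pIdem]
  rw [fIdem, ← mul_assoc, h1, h0, ← card_smul_pIdem, ← natCast_zsmul, smul_smul, smul_mul_assoc,
    mul_comm]

/-- Since e_W acts as the identity on V, this is the trace of the projector p_H, namely dim V^H. -/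
theorem charValue_fIdem (hirr : σ.IsIrreducible) (hK : charField σ = ⊥)
    (hdim : Module.finrank ℂ (Representation.invariants (σ.comp H.subtype)) = 1) :
    charValue σ (fIdem σ H) = 1 := by
  have hc : (Nat.card H : ℂ) ≠ 0 := by exact_mod_cast Nat.card_pos.ne'
  have hd : Module.finrank ℂ V ≠ 0 := by
    have := Submodule.finrank_le (Representation.invariants (σ.comp H.subtype))
    omega
  rw [charValue_eq, fIdem, map_mul, ratAction_eIdem hirr hK hd, mul_one, pIdem_eq, ratAction_smul,
    map_of_subgroupSum, map_smul, trace_subgroupSum, hdim]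
  simp

omit [FiniteDimensional ℂ V] in
theorem of_mul_fIdem {h : G} (hh : h ∈ H) :
    MonoidAlgebra.of ℚ G h * fIdem σ H = fIdem σ H := by
  rw [fIdem, pIdem_eq, ← mul_assoc, mul_smul_comm, mul_subgroupSum _ hh]

omit [FiniteDimensional ℂ V] in
theorem fIdem_mul_of {h : G} (hh : h ∈ H) :
    fIdem σ H * MonoidAlgebra.of ℚ G h = fIdem σ H := by
  rw [fIdem, mul_assoc, ← eIdem_central, ← mul_assoc, pIdem_eq, smul_mul_assoc,
    subgroupSum_mul _ hh]

omit [FiniteDimensional ℂ V] in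
/-- The coefficients of `f_{H,W̃}` are constant on double cosets. -/
theorem coeff_fIdem_eq {g g' : G} (h : DoubleCoset.mk H H g = DoubleCoset.mk H H g') :
    (fIdem σ H).coeff g = (fIdem σ H).coeff g' := by
  obtain ⟨a, ha, b, hb, rfl⟩ := (DoubleCoset.eq H H _ _).1 h
  conv_rhs => rw [← of_mul_fIdem ha, ← fIdem_mul_of hb]
  simp [MonoidAlgebra.coeff_single_mul_apply, MonoidAlgebra.coeff_mul_single_apply, mul_assoc]

end Eigenvalues

/-! ### The action on the torus -/

section Torus

variable {E : Type*} [NormedAddCommGroup E] [NormedSpace ℂ E] {Λ : Submodule ℤ E}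
  {G : Type*} [Group G] [Fintype G] (ρ : G →* torusEnd Λ) (H : Subgroup G)

theorem mul_apply (f g : torusEnd Λ) (z : E ⧸ Λ) :
    ((f * g : torusEnd Λ) : AddMonoid.End (E ⧸ Λ)) z =
      (f : AddMonoid.End (E ⧸ Λ)) ((g : AddMonoid.End (E ⧸ Λ)) z) := rfl

theorem nsmul_apply (n : ℕ) (f : torusEnd Λ) (z : E ⧸ Λ) :
    ((n • f : torusEnd Λ) : AddMonoid.End (E ⧸ Λ)) z = n • (f : AddMonoid.End (E ⧸ Λ)) z := rfl

theorem zsmul_apply (n : ℤ) (f : torusEnd Λ) (z : E ⧸ Λ) :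
    ((n • f : torusEnd Λ) : AddMonoid.End (E ⧸ Λ)) z = n • (f : AddMonoid.End (E ⧸ Λ)) z := rfl

omit [Fintype G] in
theorem groupAlgebraHom_of (g : G) :
    groupAlgebraHom ρ (MonoidAlgebra.of ℚ G g) = toEndQ Λ (ρ g) := by
  simp [groupAlgebraHom]

theorem groupAlgebraHom_cosetSum (D : DoubleCoset.Quotient (H : Set G) (H : Set G)) :
    groupAlgebraHom ρ (cosetSum (MonoidAlgebra.of ℚ G) H D) = toEndQ Λ (cosetSum ρ H D) := by
  simp only [cosetSum, map_sum, groupAlgebraHom_of]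

theorem groupAlgebraHom_subgroupSum :
    groupAlgebraHom ρ (subgroupSum (MonoidAlgebra.of ℚ G) H) = toEndQ Λ (subgroupSum ρ H) := by
  simp only [subgroupSum, map_sum, groupAlgebraHom_of]

theorem isMultiple_qElem (D : DoubleCoset.Quotient (H : Set G) (H : Set G)) :
    IsMultiple ρ (qElem H D) (Nat.card H) (cosetSum ρ H D) := by
  rw [IsMultiple, ← map_nsmul, card_smul_qElem, groupAlgebraHom_cosetSum]

theorem isMultiple_pIdem : IsMultiple ρ (pIdem H) (Nat.card H) (subgroupSum ρ H) := by
  rw [IsMultiple, ← map_nsmul, card_smul_pIdem, groupAlgebraHom_subgroupSum]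

theorem subA_eq : subA ρ H = endRange (subgroupSum ρ H) :=
  image_eq_range ρ _ _ Nat.card_pos _ (isMultiple_pIdem ρ H)

theorem mem_subA {z : E ⧸ Λ} :
    z ∈ subA ρ H ↔ ∃ w, (subgroupSum ρ H).1 w = z := by
  rw [subA_eq]
  rfl

theorem subA_divisible {n : ℕ} (hn : 0 < n) {z : E ⧸ Λ} (hz : z ∈ subA ρ H) :
    ∃ w ∈ subA ρ H, n • w = z := by
  obtain ⟨y, rfl⟩ := (mem_subA ρ H).1 hz
  obtain ⟨x, rfl⟩ := divisible Λ n hn y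
  exact ⟨_, (mem_subA ρ H).2 ⟨x, rfl⟩, (map_nsmul _ _ _).symm⟩

-- With N and C the sums over H and D, and R the sum over representatives, a point of A_H can be
-- written N(|H|x); then R N(|H|x) = |H| C x = N(C x).
variable {ρ H} in
theorem repSum_mem_subA (D : DoubleCoset.Quotient (H : Set G) (H : Set G)) {z : E ⧸ Λ}
    (hz : z ∈ subA ρ H) : (repSum ρ H D).1 z ∈ subA ρ H := by
  obtain ⟨y, rfl⟩ := (mem_subA ρ H).1 hz
  obtain ⟨x, rfl⟩ := divisible Λ (Nat.card H) Nat.card_pos y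
  refine (mem_subA ρ H).2 ⟨(cosetSum ρ H D).1 x, ?_⟩
  rw [← mul_apply, subgroupSum_mul_cosetSum, ← mul_apply, repSum_mul_subgroupSum, map_nsmul,
    nsmul_apply]

variable {ρ H} in
theorem card_smul_repSum_apply (D : DoubleCoset.Quotient (H : Set G) (H : Set G)) {z : E ⧸ Λ}
    (hz : z ∈ subA ρ H) : Nat.card H • (repSum ρ H D).1 z =
      (cosetSum ρ H D).1 z := by
  obtain ⟨y, rfl⟩ := (mem_subA ρ H).1 hz
  rw [← mul_apply, ← mul_apply, repSum_mul_subgroupSum, cosetSum_mul_subgroupSum, nsmul_apply]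

/-- The endomorphism of `A_H` induced by `q_D`. -/
noncomputable def heckeEnd (D : DoubleCoset.Quotient (H : Set G) (H : Set G)) :
    subEnd Λ (subA ρ H) where
  val := AddMonoidHom.mk'
    (fun z : subA ρ H =>
      (⟨(repSum ρ H D).1 (z : E ⧸ Λ), repSum_mem_subA D z.2⟩ : subA ρ H))
    (fun a b => Subtype.ext (map_add (repSum ρ H D).1 (a : E ⧸ Λ) b))
  property := fun x _ => by
    obtain ⟨φ, hφ, h⟩ := (repSum ρ H D).2 x
    exact ⟨φ, hφ, h.mono fun y hy _ => hy⟩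

theorem coe_heckeEnd_apply (D : DoubleCoset.Quotient (H : Set G) (H : Set G)) (z : subA ρ H) :
    (((heckeEnd ρ H D : AddMonoid.End (subA ρ H)) z : subA ρ H) : E ⧸ Λ) =
      (repSum ρ H D).1 z := rfl

theorem actsAs_heckeEnd (D : DoubleCoset.Quotient (H : Set G) (H : Set G)) :
    ActsAs ρ H (qElem H D) (heckeEnd ρ H D) :=
  ⟨Nat.card H, Nat.card_pos, _, isMultiple_qElem ρ H D, fun z => by
    rw [coe_heckeEnd_apply, card_smul_repSum_apply D z.2]⟩

variable {ρ H} in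
theorem ActsAs.unique {α : MonoidAlgebra ℚ G} {φ φ' : subEnd Λ (subA ρ H)}
    (h : ActsAs ρ H α φ) (h' : ActsAs ρ H α φ') : φ = φ' := by
  obtain ⟨n, hn, ψ, hψ, hz⟩ := h
  obtain ⟨m, hm, χ, hχ, hz'⟩ := h'
  have e : m • ψ = n • χ := by
    apply toEndQ_injective
    rw [map_nsmul, map_nsmul, ← show _ = _ from hψ, ← show _ = _ from hχ, smul_smul, smul_smul,
      mul_comm]
  ext z
  -- Dividing z by mn inside A_H turns the equality of the two endomorphisms after multiplication by
  -- mn into equality at z.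
  obtain ⟨w, hw, hwz⟩ := subA_divisible ρ H (Nat.mul_pos hm hn) z.2
  have hz0 : z = (m * n) • (⟨w, hw⟩ : subA ρ H) := Subtype.ext hwz.symm
  have e' := congrArg (fun k : torusEnd Λ => k.1 w) e
  rw [hz0, map_nsmul, map_nsmul, mul_smul, mul_comm, mul_smul, AddSubgroup.coe_nsmul,
    AddSubgroup.coe_nsmul, AddSubgroup.coe_nsmul, AddSubgroup.coe_nsmul, hz ⟨w, hw⟩, hz' ⟨w, hw⟩]
  exact e'

theorem existsUnique_actsAs (D : DoubleCoset.Quotient (H : Set G) (H : Set G)) :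
    ∃! φ : subEnd Λ (subA ρ H), ActsAs ρ H (qElem H D) φ :=
  ⟨heckeEnd ρ H D, actsAs_heckeEnd ρ H D, fun _ h => h.unique (actsAs_heckeEnd ρ H D)⟩

variable {V : Type*} [AddCommGroup V] [Module ℂ V] (σ : Representation ℂ G V)

-- Uniqueness of the induced endomorphism and injectivity of ℤ → ℂ replace the existential choices
-- by the concrete operator and integer.
variable {ρ H σ} in
theorem mem_eigenLocus_iff (c : DoubleCoset.Quotient (H : Set G) (H : Set G) → ℤ)
    (hc : ∀ D, charValue σ (qElem H D) = c D) {z : E ⧸ Λ} :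
    z ∈ eigenLocus ρ H σ ↔
      z ∈ subA ρ H ∧ ∀ D, (repSum ρ H D).1 z = c D • z := by
  constructor
  · rintro ⟨hz, h⟩
    refine ⟨hz, fun D => ?_⟩
    obtain ⟨φ, m, hφ, hm, e⟩ := h D
    rw [hφ.unique (actsAs_heckeEnd ρ H D), coe_heckeEnd_apply] at e
    have : m = c D := by exact_mod_cast hm.symm.trans (hc D)
    rw [← this]
    exact e
  · rintro ⟨hz, h⟩
    exact ⟨hz, fun D => ⟨heckeEnd ρ H D, c D, actsAs_heckeEnd ρ H D, hc D, h D⟩⟩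

variable {ρ H σ} in
/-- The image of a multiple of `f_{H,W̃}` is contained in the eigenlocus. -/
theorem endRange_subset_eigenLocus (c : DoubleCoset.Quotient (H : Set G) (H : Set G) → ℤ)
    (hc : ∀ D, charValue σ (qElem H D) = c D)
    (hcσ : ∀ D, cosetSum σ H D = c D • subgroupSum σ H) (hK : charField σ = ⊥)
    {n : ℕ} {θ : torusEnd Λ} (hθ : IsMultiple ρ (fIdem σ H) n θ) :
    (endRange θ : Set (E ⧸ Λ)) ⊆ eigenLocus ρ H σ := by
  have hsub : ∀ w, (θ : AddMonoid.End (E ⧸ Λ)) w ∈ subA ρ H := by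
    intro w
    obtain ⟨w', rfl⟩ := divisible Λ (Nat.card H) Nat.card_pos w
    have e : subgroupSum ρ H * θ = Nat.card H • θ := by
      apply toEndQ_injective
      rw [map_mul, map_nsmul, ← show _ = _ from hθ, ← groupAlgebraHom_subgroupSum,
        ← map_nsmul, ← map_mul, ← map_nsmul, mul_smul_comm, ← card_smul_pIdem, smul_mul_assoc,
        fIdem, ← mul_assoc, pIdem_mul_self, smul_comm]
    refine (mem_subA ρ H).2 ⟨(θ : AddMonoid.End (E ⧸ Λ)) w', ?_⟩
    rw [← mul_apply, e, nsmul_apply, map_nsmul]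
  rintro _ ⟨w, rfl⟩
  refine (mem_eigenLocus_iff c hc).2 ⟨hsub w, fun D => ?_⟩
  -- Dividing w by |H| supplies the factor that converts the representative sum into the coset sum,
  -- for which the eigenvalue relation holds in ℚ[G].
  obtain ⟨w', rfl⟩ := divisible Λ (Nat.card H) Nat.card_pos w
  have e : cosetSum ρ H D * θ = ((Nat.card H : ℤ) * c D) • θ := by
    apply toEndQ_injective
    rw [map_mul, map_zsmul, ← show _ = _ from hθ, ← groupAlgebraHom_cosetSum, ← map_nsmul,
      ← map_mul, ← map_zsmul, mul_smul_comm, cosetSum_mul_fIdem hK (hcσ D), smul_comm]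
  rw [map_nsmul, map_nsmul, card_smul_repSum_apply D (hsub w'), ← mul_apply, e, zsmul_apply,
    mul_smul, natCast_zsmul, smul_comm]

omit [Group G] in
/-- A common denominator of the coefficients of an element of `ℚ[G]`. -/
theorem exists_int_coeff (α : MonoidAlgebra ℚ G) :
    ∃ n : ℕ, 0 < n ∧ ∃ k : G → ℤ, ∀ g, (k g : ℚ) = n * α.coeff g := by
  refine ⟨∏ g : G, (α.coeff g).den, Finset.prod_pos fun g _ => Rat.den_pos _, ?_⟩
  have : ∀ g, ∃ k : ℤ, (k : ℚ) = (∏ g : G, (α.coeff g).den : ℕ) * α.coeff g := by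
    intro g
    obtain ⟨m, hm⟩ := Finset.dvd_prod_of_mem (fun g => (α.coeff g).den) (Finset.mem_univ g)
    refine ⟨m * (α.coeff g).num, ?_⟩
    rw [hm]
    push_cast
    rw [mul_comm ((α.coeff g).den : ℚ), mul_assoc, Rat.den_mul_eq_num]
  choose k hk using this
  exact ⟨k, hk⟩

theorem isMultiple_sum {α : MonoidAlgebra ℚ G} {n : ℕ} {k : G → ℤ}
    (hk : ∀ g, (k g : ℚ) = n * α.coeff g) : IsMultiple ρ α n (∑ g, k g • ρ g) := by
  have e : n • α = ∑ g : G, k g • MonoidAlgebra.of ℚ G g := by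
    conv_lhs => rw [eq_sum_coeff α]
    rw [Finset.smul_sum]
    refine Finset.sum_congr rfl fun g _ => ?_
    rw [← Nat.cast_smul_eq_nsmul ℚ, smul_smul, ← hk, Int.cast_smul_eq_zsmul]
  rw [IsMultiple, ← map_nsmul, e, map_sum, map_sum]
  exact Finset.sum_congr rfl fun g _ => by rw [map_zsmul, map_zsmul, groupAlgebraHom_of]

theorem sum_apply {ι : Type*} (s : Finset ι) (f : ι → torusEnd Λ) (z : E ⧸ Λ) :
    (∑ i ∈ s, f i).1 z = ∑ i ∈ s, (f i).1 z := by
  classical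
  induction s using Finset.induction_on with
  | empty => simp
  | insert i s hi ih =>
    rw [Finset.sum_insert hi, Finset.sum_insert hi, ← ih]
    rfl

variable {ρ H} in
/-- If every `q_D` acts on `z` and on the line `V^H` by the same integer, then so does every integral
combination of the elements of `G` whose coefficients are constant on double cosets. -/
theorem sum_smul_apply {c : DoubleCoset.Quotient (H : Set G) (H : Set G) → ℤ}
    (hcσ : ∀ D, cosetSum σ H D = c D • subgroupSum σ H) {k : G → ℤ}
    (hkc : ∀ g g', DoubleCoset.mk H H g = DoubleCoset.mk H H g' → k g = k g')
    (htr : LinearMap.trace ℂ V (subgroupSum σ H) = Nat.card H)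
    {m : ℤ} (hm : ∑ g, (k g : ℂ) * σ.character g = m)
    {z : E ⧸ Λ} (hz : z ∈ subA ρ H)
    (hzc : ∀ D, (repSum ρ H D).1 z = c D • z) :
    (∑ g, k g • ρ g).1 z = m • z := by
  classical
  have : Fintype (DoubleCoset.Quotient (H : Set G) (H : Set G)) :=
    Fintype.ofSurjective (DoubleCoset.mk H H) Quotient.mk''_surjective
  -- Taking the trace on V of the double coset decomposition expresses m by the same coefficients
  -- that occur in the action on z.
  have hm' : m = ∑ D : DoubleCoset.Quotient (H : Set G) (H : Set G),
      k (Quotient.out D) * (Nat.card H * c D) := by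
    have h := congrArg (LinearMap.trace ℂ V) (sum_smul_eq σ H hkc)
    rw [map_sum, map_sum] at h
    simp only [map_zsmul, hcσ, htr] at h
    rw [← Int.cast_inj (α := ℂ), ← hm, Int.cast_sum]
    simpa [Representation.character, mul_comm] using h
  rw [sum_smul_eq ρ H hkc, hm', Finset.sum_smul, sum_apply]
  refine Finset.sum_congr rfl fun D _ => ?_
  rw [zsmul_apply, ← card_smul_repSum_apply D hz, hzc D, ← natCast_zsmul, smul_smul, smul_smul,
    mul_assoc]

end Torus

end HeckeAV

theorem theorem4p3
    {E : Type*} [NormedAddCommGroup E] [NormedSpace ℂ E] [FiniteDimensional ℂ E]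
    (Λ : Submodule ℤ E) [DiscreteTopology Λ] [IsZLattice ℝ Λ]
    (hA : HeckeAV.IsAbelianVariety Λ)
    {G : Type*} [Group G] [Fintype G] (ρ : G →* HeckeAV.torusEnd Λ) (H : Subgroup G)
    {V : Type*} [AddCommGroup V] [Module ℂ V] [FiniteDimensional ℂ V]
    (σ : Representation ℂ G V) (hirr : σ.IsIrreducible)
    (hdim : Module.finrank ℂ (Representation.invariants (σ.comp H.subtype)) = 1)
    (hK : HeckeAV.charField σ = ⊥) :
    (∀ D : DoubleCoset.Quotient (H : Set G) (H : Set G),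
      (∃! φ : HeckeAV.subEnd Λ (HeckeAV.subA ρ H),
        HeckeAV.ActsAs ρ H (HeckeAV.qElem H D) φ) ∧
      ∃ c : ℤ, HeckeAV.charValue σ (HeckeAV.qElem H D) = c) ∧
    (HeckeAV.isoComp ρ H σ : Set (E ⧸ Λ)) = HeckeAV.eigenComp ρ H σ := by
  choose c hc hcσ using HeckeAV.exists_int_eigenvalue hK hdim
  refine ⟨fun D => ⟨HeckeAV.existsUnique_actsAs ρ H D, c D, hc D⟩, ?_⟩
  obtain ⟨n, hn, k, hk⟩ := HeckeAV.exists_int_coeff (HeckeAV.fIdem σ H)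
  have hmul := HeckeAV.isMultiple_sum ρ hk
  have hsub := HeckeAV.endRange_subset_eigenLocus c hc hcσ hK hmul
  have h0 := hsub (HeckeAV.endRange _).zero_mem
  rw [HeckeAV.isoComp, HeckeAV.image_eq_range ρ _ n hn _ hmul]
  refine subset_antisymm ((HeckeAV.isPreconnected_endRange _).subset_connectedComponentIn
    (HeckeAV.endRange _).zero_mem hsub) ?_
  refine HeckeAV.subset_endRange_of_isPreconnected _ isPreconnected_connectedComponentIn
    (mem_connectedComponentIn h0) hn fun z hz => ?_
  obtain ⟨hzA, hzc⟩ := (HeckeAV.mem_eigenLocus_iff c hc).1 (connectedComponentIn_subset _ _ hz)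
  have hkc : ∀ g g', DoubleCoset.mk H H g = DoubleCoset.mk H H g' → k g = k g' := by
    intro g g' h
    rw [← Int.cast_inj (α := ℚ), hk, hk, HeckeAV.coeff_fIdem_eq h]
  -- The left side is the trace on V of n f, where f has character value 1.
  have hm : ∑ g, (k g : ℂ) * σ.character g = (n : ℤ) := by
    have h := HeckeAV.charValue_fIdem hirr hK hdim
    rw [HeckeAV.charValue_eq_sum] at h
    rw [Int.cast_natCast, ← mul_one (n : ℂ), ← h, Finset.mul_sum]
    refine Finset.sum_congr rfl fun g _ => ?_
    rw [← mul_assoc]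
    congr 1
    exact_mod_cast congrArg (Rat.cast (K := ℂ)) (hk g)
  have htr : LinearMap.trace ℂ V (HeckeAV.subgroupSum σ H) = Nat.card H := by
    rw [HeckeAV.trace_subgroupSum, hdim, Nat.cast_one, mul_one]
  rw [← natCast_zsmul, ← HeckeAV.sum_smul_apply σ hcσ hkc htr hm hzA hzc]
  exact ⟨z, rfl⟩
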